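/- Let $R$ be a Prüfer domain (a commutative integral domain all of whose localizations at maximal ideals are valuation domains) which is effectively given: its elements are listed, possibly with repetitions, as $a_0=0,a_1=1,a_2,\dots$ in such a way that, for $m,n$ ranging over the natural numbers, there are algorithms deciding whether $a_m=a_n$, producing indices of $a_m+a_n$ and of $a_m a_n$, and deciding whether $a_m$ divides $a_n$. Let $L_R$ be the first-order language of $R$-modules, with symbols $0$, $+$ and a unary function symbol for each $r\in R$, and let $T_R$ be the theory of $R$-modules, that is, the set of $L_R$-sentences true in all $R$-modules; algorithms handle scalars through their indices in the list and sentences through Gödel numbers. For an integer $l\ge 1$ let $\mathrm{PP}_l(R)$ be the set of tuples $(p,n,c_1,\dots,c_l,d)$, with $p$ prime, $n\ge 1$ an integer and $c_1,\dots,c_l,d\in R$, for which there are positive integers $s,k_1,\dots,k_s$ and maximal ideals $\mathfrak m_1,\dots,\mathfrak m_s$ of $R$ such that $n$ is a linear combination of $k_1,\dots,k_s$ with non-negative integer coefficients and, for $i=1,\dots,s$, $|R/\mathfrak m_i|=p^{k_i}$, $c_j\in\mathfrak m_i$ for all $1\le j\le l$, and $d\notin\mathfrak m_i$. Put $\mathrm{PP}^\star(R)=\bigcup_{l\ge1}\mathrm{PP}_l(R)$.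 (1) If $T_R$ is decidable, then $\mathrm{PP}^\star(R)$ is recursive. (2) For every prime $p$, all integers $n,l\ge1$ and all $c_1,\dots,c_l,d\in R$, the tuple $(p,n,c_1,\dots,c_l,d)$ lies in $\mathrm{PP}_l(R)$ if and only if there is an $R$-module $M$ such that $|M|=p^n$, every $c_j$ annihilates $M$, and no nonzero element of $M$ is annihilated by $d$. (3) There is an algorithm which, given $\pi=(p,n,c_1,\dots,c_l,d)$ with $p$ prime, $n,l\ge1$ and $c_1,\dots,c_l,d\in R$, produces an $L_R$-sentence $\theta_\pi$ that is true in an $R$-module $M$ if and only if $M$ satisfies the condition on $M$ in (2). -/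

import Mathlib

universe u

namespace PruferModules

open FirstOrder

/-- A domain is Prüfer if its localizations at maximal ideals are valuation domains. -/
def IsPruferDomain (R : Type u) [CommRing R] [IsDomain R] : Prop :=
  ∀ (m : Ideal R) [m.IsMaximal], ValuationRing (Localization.AtPrime m)

/-- `a 0, a 1, a 2, …` is a listing (possibly with repetitions) of all elements of `R`, starting
with `0, 1`, for which equality and divisibility are decidable and addition and multiplication
are computable on indices. -/
structure EffectiveListing (R : Type u) [CommRing R] (a : ℕ → R) : Prop where
  surjective : Function.Surjective a
  zero : a 0 = 0
  one : a 1 = 1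
  eq_decidable : ComputablePred fun x : ℕ × ℕ => a x.1 = a x.2
  add_computable : ∃ f : ℕ → ℕ → ℕ, Computable₂ f ∧ ∀ m n, a (f m n) = a m + a n
  mul_computable : ∃ f : ℕ → ℕ → ℕ, Computable₂ f ∧ ∀ m n, a (f m n) = a m * a n
  dvd_decidable : ComputablePred fun x : ℕ × ℕ => a x.1 ∣ a x.2

/-! ### The language of modules -/

/-- Function symbols of the language of modules with scalars in `S`: a constant `0`, a binary `+`,
and for each `s : S` a unary symbol for multiplication by `s`. -/
inductive ModFunc (S : Type u) : ℕ → Type u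
  | zero : ModFunc S 0
  | smul (s : S) : ModFunc S 1
  | add : ModFunc S 2

/-- The language of modules with scalars in `S`; equality is its only relation. -/
def modLang (S : Type u) : FirstOrder.Language.{u, 0} where
  Functions := ModFunc S
  Relations := fun _ => Empty

/-- An `R`-module as a structure for the language of `R`-modules. -/
abbrev moduleStructure (R M : Type u) [CommRing R] [AddCommGroup M] [Module R M] :
    (modLang R).Structure M where
  funMap := fun {_} f =>
    match f with
    | ModFunc.zero => fun _ => 0
    | ModFunc.smul r => fun x => r • x 0
    | ModFunc.add => fun x => x 0 + x 1
  RelMap := fun r => nomatch r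

/-- The sentence `φ` of the language of `R`-modules is true in the `R`-module `M`. -/
def TrueIn {R : Type u} [CommRing R] (M : Type u) [AddCommGroup M] [Module R M]
    (φ : (modLang R).Sentence) : Prop :=
  @FirstOrder.Language.Sentence.Realize (modLang R) M (moduleStructure R M) φ

/-- The theory `T_R` of `R`-modules: the sentences true in all `R`-modules. -/
def theoryOfModules (R : Type u) [CommRing R] : Set (modLang R).Sentence :=
  {φ | ∀ (M : Type u) [AddCommGroup M] [Module R M], TrueIn M φ}

/-! ### Gödel numbers

A sentence is presented to an algorithm with its scalars replaced by indices in the listing,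
that is, as a sentence of `modLang ℕ`. -/

/-- Replace every scalar `s` by `a s`. -/
def scalarHom {S : Type*} {R : Type*} (a : S → R) : modLang S →ᴸ modLang R where
  onFunction := fun {_} f =>
    match f with
    | ModFunc.zero => ModFunc.zero
    | ModFunc.smul s => ModFunc.smul (a s)
    | ModFunc.add => ModFunc.add
  onRelation := fun {_} r => nomatch r

/-- The sentence of the language of `R`-modules presented by a sentence with scalar indices. -/
def interpret {R : Type u} (a : ℕ → R) (φ : (modLang ℕ).Sentence) : (modLang R).Sentence :=
  (scalarHom a).onSentence φ

/-- Gödel number of a function symbol. -/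
def funcCode : {k : ℕ} → ModFunc ℕ k → ℕ
  | _, ModFunc.zero => 0
  | _, ModFunc.add => 1
  | _, ModFunc.smul i => i + 2

/-- Gödel number of a term in the bound variables `0, …, n - 1`. -/
def termCode {n : ℕ} : (modLang ℕ).Term (Empty ⊕ Fin n) → ℕ
  | .var (.inr i) => Nat.pair 0 i
  | .func f ts => Nat.pair (funcCode f + 1) (Encodable.encode (List.ofFn fun i => termCode (ts i)))

/-- Gödel number of a formula. -/
def formulaCode : {n : ℕ} → (modLang ℕ).BoundedFormula Empty n → ℕ
  | _, .falsum => Nat.pair 0 0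
  | _, .equal t₁ t₂ => Nat.pair 1 (Nat.pair (termCode t₁) (termCode t₂))
  | _, .rel r _ => nomatch r
  | _, .imp φ ψ => Nat.pair 2 (Nat.pair (formulaCode φ) (formulaCode ψ))
  | _, .all φ => Nat.pair 3 (formulaCode φ)

/-- Gödel number of a sentence with scalar indices. -/
def sentenceCode (φ : (modLang ℕ).Sentence) : ℕ := formulaCode φ

/-- The theory of `R`-modules is decidable with respect to the listing `a`: an algorithm decides
from the Gödel number of a sentence whether it is true in all `R`-modules. -/
def DecidableTheory (R : Type u) [CommRing R] (a : ℕ → R) : Prop :=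
  ∃ f : ℕ → Bool, Computable f ∧
    ∀ φ : (modLang ℕ).Sentence, f (sentenceCode φ) = true ↔ interpret a φ ∈ theoryOfModules R

/-! ### The sets `PP_l(R)` and `PP*(R)` -/

/-- The set `PP_l(R)` of tuples `(p, n, c_1, …, c_l, d)`. -/
def PPl (R : Type u) [CommRing R] (l : ℕ) : Set (ℕ × ℕ × (Fin l → R) × R) :=
  {x | match x with
    | (p, n, c, d) =>
      p.Prime ∧ 0 < n ∧
        ∃ (s : ℕ) (k : Fin s → ℕ) (m : Fin s → Ideal R), 0 < s ∧
          n ∈ Submodule.span ℕ (Set.range k) ∧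
          ∀ i, 0 < k i ∧ (m i).IsMaximal ∧ Nat.card (R ⧸ m i) = p ^ k i ∧
            (∀ j, c j ∈ m i) ∧ d ∉ m i}

/-- The union `PP*(R)` of the sets `PP_l(R)` over `l ≥ 1`; the tuple `(c_1, …, c_l)` of variable
length is a list. -/
def PPstar (R : Type u) [CommRing R] : Set (ℕ × ℕ × List R × R) :=
  {x | ∃ (l p n : ℕ) (c : Fin l → R) (d : R),
    1 ≤ l ∧ (p, n, c, d) ∈ PPl R l ∧ x = (p, n, List.ofFn c, d)}

/-- `PP*(R)` is recursive with respect to the listing `a`. -/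
def PPstarRecursive (R : Type u) [CommRing R] (a : ℕ → R) : Prop :=
  ComputablePred fun x : ℕ × ℕ × List ℕ × ℕ =>
    (x.1, x.2.1, x.2.2.1.map a, a x.2.2.2) ∈ PPstar R

/-- The module `M` has `p ^ n` elements, is annihilated by all `c ∈ cs`, and has no nonzero
element killed by `d`. -/
def WitnessModule {R : Type u} [CommRing R] (p n : ℕ) (cs : Set R) (d : R)
    (M : Type u) [AddCommGroup M] [Module R M] : Prop :=
  Nat.card M = p ^ n ∧ (∀ c ∈ cs, c ∈ Module.annihilator R M) ∧ ∀ x : M, d • x = 0 → x = 0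

end PruferModules

/-! The tuple lies in `PPl` exactly when `n` is in the additive monoid generated by the exponents of
the admissible residue fields, and a witness module realizes such a decomposition of `n`. Given a
decomposition, a direct sum of residue fields is a witness. Conversely, a finite witness has a
simple submodule `R ⧸ m`; its exponent is admissible, and the quotient by it is again a witness, so
induction on `n` applies (`exists_witnessModule_of_mem_span`, `mem_span_of_witnessModule`).

Being a witness is first-order: annihilation by each `c`, injectivity of `d` and cardinality `p ^ n`
are finitely many axioms, so one sentence expresses them, and its Gödel number is primitive
recursive in the tuple (`trueIn_witnessSentence_iff`, `primrec_witnessCode`). A tuple has a witness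
iff the negated sentence is not in the theory of modules, so a decision procedure for the theory
decides `PPstar`. -/

namespace PruferModules

open FirstOrder FirstOrder.Language

/-! ### Witness modules and residue fields -/

section Algebra

variable {R : Type u} [CommRing R]

/-- The exponents `k ≥ 1` of cardinalities `p ^ k` of residue fields of `R` at maximal ideals
containing `cs` and not containing `d`. -/
def residueExponents (R : Type u) [CommRing R] (p : ℕ) (cs : Set R) (d : R) : Set ℕ :=
  {k | 0 < k ∧ ∃ m : Ideal R, m.IsMaximal ∧ Nat.card (R ⧸ m) = p ^ k ∧ cs ⊆ m ∧ d ∉ m}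

theorem mem_PPl_iff {p n l : ℕ} {c : Fin l → R} {d : R} (hp : p.Prime) (hn : 0 < n) :
    (p, n, c, d) ∈ PPl R l ↔
      n ∈ Submodule.span ℕ (residueExponents R p (Set.range c) d) := by
  constructor
  · rintro ⟨-, -, s, k, m, -, hspan, h⟩
    refine Submodule.span_mono ?_ hspan
    rintro _ ⟨i, rfl⟩
    obtain ⟨hk, hmax, hcard, hc, hd⟩ := h i
    exact ⟨hk, m i, hmax, hcard, Set.range_subset_iff.2 hc, hd⟩
  · intro h
    obtain ⟨t, ht, hnt⟩ := Submodule.mem_span_finite_of_mem_span h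
    -- Positivity of `n` excludes the empty family, whose span is zero.
    have hcard : 0 < t.card := by
      rw [Finset.card_pos, Finset.nonempty_iff_ne_empty]
      rintro rfl
      simp only [Finset.coe_empty, Submodule.span_empty, Submodule.mem_bot] at hnt
      exact hn.ne' hnt
    have ht' : ∀ i, ((t.equivFin.symm i : t) : ℕ) ∈ residueExponents R p (Set.range c) d :=
      fun i => ht (t.equivFin.symm i).2
    choose hk m hm using ht'
    refine ⟨hp, hn, t.card, fun i => (t.equivFin.symm i : t), m, hcard, ?_, fun i => ?_⟩
    · convert hnt
      ext x
      simp only [Set.mem_range, Finset.mem_coe]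
      exact ⟨fun ⟨i, hi⟩ => hi ▸ (t.equivFin.symm i).2,
        fun hx => ⟨t.equivFin ⟨x, hx⟩, by simp⟩⟩
    · obtain ⟨hmax, hc, hcs, hd⟩ := hm i
      exact ⟨hk i, hmax, hc, fun j => hcs ⟨j, rfl⟩, hd⟩

/-- Exponents add under direct sums: generators are realized by `R ⧸ m`, sums by products, multiples
by powers, and `0` by the zero module. -/
theorem exists_witnessModule_of_mem_span {p n : ℕ} {cs : Set R} {d : R}
    (h : n ∈ Submodule.span ℕ (residueExponents R p cs d)) :
    ∃ (M : Type u) (_ : AddCommGroup M) (_ : Module R M), WitnessModule p n cs d M := by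
  induction h using Submodule.span_induction with
  | mem k hk =>
    obtain ⟨-, m, hm, hcard, hcs, hd⟩ := hk
    refine ⟨R ⧸ m, inferInstance, inferInstance, hcard, fun c hc => ?_, fun x hx => ?_⟩
    · rw [Ideal.annihilator_quotient]
      exact hcs hc
    · obtain ⟨r, rfl⟩ := Ideal.Quotient.mk_surjective x
      have hx : Ideal.Quotient.mk m (d * r) = 0 := hx
      rw [Ideal.Quotient.eq_zero_iff_mem] at hx
      exact Ideal.Quotient.eq_zero_iff_mem.2 ((hm.isPrime.mem_or_mem hx).resolve_left hd)
  | zero =>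
    exact ⟨PUnit, inferInstance, inferInstance, by simp, fun c _ => by
      simp [Module.mem_annihilator], fun x _ => Subsingleton.elim _ _⟩
  | add i j _ _ hi hj =>
    obtain ⟨M, _, _, hM, hMc, hMd⟩ := hi
    obtain ⟨N, _, _, hN, hNc, hNd⟩ := hj
    refine ⟨M × N, inferInstance, inferInstance, ?_, fun c hc => ?_, fun x hx => ?_⟩
    · rw [Nat.card_prod, hM, hN, pow_add]
    · exact Module.mem_annihilator.2 fun x => Prod.ext
        (Module.mem_annihilator.1 (hMc c hc) x.1) (Module.mem_annihilator.1 (hNc c hc) x.2)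
    · exact Prod.ext (hMd _ (congrArg Prod.fst hx)) (hNd _ (congrArg Prod.snd hx))
  | smul a i _ hi =>
    obtain ⟨M, _, _, hM, hMc, hMd⟩ := hi
    refine ⟨Fin a → M, inferInstance, inferInstance, ?_, fun c hc => ?_, fun x hx => ?_⟩
    · rw [Nat.card_fun, hM, Nat.card_fin, ← pow_mul, smul_eq_mul, mul_comm]
    · exact Module.mem_annihilator.2 fun x => funext fun i =>
        Module.mem_annihilator.1 (hMc c hc) (x i)
    · exact funext fun i => hMd _ (congrFun hx i)

/-- Strong induction on the exponent, splitting off one simple submodule at a time. -/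
theorem mem_span_of_witnessModule {p : ℕ} (hp : p.Prime) {cs : Set R} {d : R} (n : ℕ)
    (M : Type u) [AddCommGroup M] [Module R M] (h : WitnessModule p n cs d M) :
    n ∈ Submodule.span ℕ (residueExponents R p cs d) := by
  induction n using Nat.strong_induction_on generalizing M with
  | _ n ih =>
  obtain ⟨hcard, hc, hd⟩ := h
  rcases Nat.eq_zero_or_pos n with rfl | hn
  · exact Submodule.zero_mem _
  have hfin : Finite M := Nat.finite_of_card_ne_zero (by rw [hcard]; exact (pow_pos hp.pos n).ne')
  have : Nontrivial M := Finite.one_lt_card_iff_nontrivial.1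
    (by rw [hcard]; exact Nat.one_lt_pow hn.ne' hp.one_lt)
  obtain ⟨S, hS⟩ := IsAtomic.exists_atom (Submodule R M)
  have hsimple : IsSimpleModule R S := isSimpleModule_iff_isAtom.2 hS
  obtain ⟨m, hm, ⟨e⟩⟩ := isSimpleModule_iff_quot_maximal.1 hsimple
  have hmul : Nat.card (M ⧸ S) * Nat.card S = p ^ n := by
    rw [← hcard]
    exact (AddSubgroup.card_eq_card_quotient_mul_card_addSubgroup S.toAddSubgroup).symm
  obtain ⟨k, -, hk⟩ := (Nat.dvd_prime_pow hp).1 (Dvd.intro_left _ hmul)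
  obtain ⟨j, -, hj⟩ := (Nat.dvd_prime_pow hp).1 (Dvd.intro _ hmul)
  have hjk : j + k = n := by
    rw [hj, hk, ← pow_add] at hmul
    exact Nat.pow_right_injective hp.two_le hmul
  have hSnt : Nontrivial S := IsSimpleModule.nontrivial R S
  have hk0 : 0 < k := by
    have := Finite.one_lt_card_iff_nontrivial.2 hSnt
    rw [hk] at this
    exact Nat.pos_of_ne_zero fun h0 => by simp [h0] at this
  have hkmem : k ∈ residueExponents R p cs d := by
    refine ⟨hk0, m, hm, ?_, fun c hcc => ?_, fun hdm => ?_⟩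
    · rw [← hk]
      exact (Nat.card_congr e.toEquiv).symm
    · have : c ∈ Module.annihilator R (R ⧸ m) := by
        rw [← e.annihilator_eq]
        exact Module.mem_annihilator.2 fun x => Subtype.ext
          (Module.mem_annihilator.1 (hc c hcc) (x : M))
      rwa [Ideal.annihilator_quotient] at this
    · have : d ∈ Module.annihilator R S := by
        rw [e.annihilator_eq, Ideal.annihilator_quotient]
        exact hdm
      obtain ⟨x, hx⟩ := exists_ne (0 : S)
      exact hx (Subtype.ext (hd x (congrArg Subtype.val (Module.mem_annihilator.1 this x))))
  rw [← hjk]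
  refine Submodule.add_mem _ (ih j (by omega) (M ⧸ S) ⟨hj, fun c hcc => ?_, ?_⟩)
    (Submodule.subset_span hkmem)
  · refine Module.mem_annihilator.2 fun x => ?_
    obtain ⟨y, rfl⟩ := S.mkQ_surjective x
    rw [← map_smul, Module.mem_annihilator.1 (hc c hcc), map_zero]
  -- Injectivity does not pass to quotients in general, but surjectivity does, and on finite modules
  -- the two agree.
  · have hinj : Function.Injective fun x : M => d • x :=
      (injective_iff_map_eq_zero (DistribSMul.toAddMonoidHom M d)).2 hd
    have hsurj : Function.Surjective fun x : M ⧸ S => d • x := by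
      intro x
      obtain ⟨y, rfl⟩ := S.mkQ_surjective x
      obtain ⟨z, rfl⟩ := Finite.surjective_of_injective hinj y
      exact ⟨S.mkQ z, (map_smul _ _ _).symm⟩
    have : Finite (M ⧸ S) := Finite.of_surjective _ S.mkQ_surjective
    exact (injective_iff_map_eq_zero (DistribSMul.toAddMonoidHom (M ⧸ S) d)).1
      (Finite.injective_iff_surjective.2 hsurj)

theorem mem_PPl_iff_exists_witnessModule {p n l : ℕ} {c : Fin l → R} {d : R} (hp : p.Prime)
    (hn : 0 < n) :
    (p, n, c, d) ∈ PPl R l ↔ ∃ (M : Type u) (_ : AddCommGroup M) (_ : Module R M),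
      WitnessModule p n (Set.range c) d M := by
  rw [mem_PPl_iff hp hn]
  exact ⟨exists_witnessModule_of_mem_span, fun ⟨M, _, _, h⟩ => mem_span_of_witnessModule hp n M h⟩

theorem mem_PPstar_iff {p n : ℕ} {cs : List R} {d : R} :
    (p, n, cs, d) ∈ PPstar R ↔ p.Prime ∧ 0 < n ∧ cs ≠ [] ∧
      ∃ (M : Type u) (_ : AddCommGroup M) (_ : Module R M),
        WitnessModule p n {c | c ∈ cs} d M := by
  have hrange : ∀ {l : ℕ} (c : Fin l → R), {x | x ∈ List.ofFn c} = Set.range c := fun c => by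
    ext x
    simp [List.mem_ofFn]
  constructor
  · rintro ⟨l, p, n, c, d, hl, hmem, heq⟩
    obtain ⟨rfl, rfl, rfl, rfl⟩ : _ = p ∧ _ = n ∧ _ = List.ofFn c ∧ _ = d := by simpa using heq
    have hp := hmem.1
    have hn := hmem.2.1
    refine ⟨hp, hn, ?_, ?_⟩
    · rw [Ne, List.ofFn_eq_nil_iff]
      omega
    · rw [hrange]
      exact (mem_PPl_iff_exists_witnessModule hp hn).1 hmem
  · rintro ⟨hp, hn, hcs, h⟩
    refine ⟨cs.length, p, n, cs.get, d, List.length_pos_iff.2 hcs, ?_, by rw [List.ofFn_get]⟩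
    rw [mem_PPl_iff_exists_witnessModule hp hn, ← hrange, List.ofFn_get]
    exact h

end Algebra

/-! ### The first-order sentence for witness modules -/

section Sentences

/-- The variable with index `i % (k + 1)`. -/
def boundVar (k i : ℕ) : (modLang ℕ).Term (Empty ⊕ Fin (k + 1)) :=
  .var (.inr (Fin.ofNat (k + 1) i))

/-- `x_k ≠ x_0 → ⋯ → x_k ≠ x_{i-1} → φ`. -/
def distinctImp (k : ℕ) (φ : (modLang ℕ).BoundedFormula Empty (k + 1)) :
    ℕ → (modLang ℕ).BoundedFormula Empty (k + 1)
  | 0 => φ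
  | i + 1 => .imp (.imp (.equal (boundVar k k) (boundVar k i)) .falsum) (distinctImp k φ i)

/-- For distinct `x_0, …, x_{k-1}`, this says that there are exactly `j` other elements. -/
def exactlyMore : (j k : ℕ) → (modLang ℕ).BoundedFormula Empty k
  | 0, k => .all (distinctImp k .falsum k)
  | j + 1, k => .imp (.all (distinctImp k (.imp (exactlyMore j (k + 1)) .falsum) k)) .falsum

/-- The term `s • x_0`. -/
def smulTerm (s : ℕ) : (modLang ℕ).Term (Empty ⊕ Fin 1) :=
  .func (ModFunc.smul s : (modLang ℕ).Functions 1) fun _ => boundVar 0 0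

/-- The term `0`. -/
def zeroTerm : (modLang ℕ).Term (Empty ⊕ Fin 1) :=
  .func (ModFunc.zero : (modLang ℕ).Functions 0) Fin.elim0

/-- `∀ x, s • x = 0`. -/
def killedBy (s : ℕ) : (modLang ℕ).Sentence :=
  .all (.equal (smulTerm s) zeroTerm)

/-- `∀ x, s • x = 0 → x = 0`. -/
def torsionFreeFor (s : ℕ) : (modLang ℕ).Sentence :=
  .all (.imp (.equal (smulTerm s) zeroTerm) (.equal (boundVar 0 0) zeroTerm))

/-- The sentence which defines the witness modules for a tuple of indices. -/
def witnessSentence (x : ℕ × ℕ × List ℕ × ℕ) : (modLang ℕ).Sentence :=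
  .imp
    (x.2.2.1.foldr (fun c φ => .imp (killedBy c) φ)
      (.imp (torsionFreeFor x.2.2.2) (.imp (exactlyMore (x.1 ^ x.2.1) 0) .falsum)))
    .falsum

section Semantics

theorem realize_distinctImp {M : Type u} [(modLang ℕ).Structure M] {k : ℕ} (xs : Fin k → M)
    (y : M) (v : Empty → M) (φ : (modLang ℕ).BoundedFormula Empty (k + 1)) (i : ℕ) (hi : i ≤ k) :
    (distinctImp k φ i).Realize v (Fin.snoc xs y) ↔
      ((∀ j : Fin k, (j : ℕ) < i → y ≠ xs j) → φ.Realize v (Fin.snoc xs y)) := by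
  induction i with
  | zero => simp [distinctImp]
  | succ i ih =>
    have h1 : (Fin.snoc xs y : Fin (k + 1) → M) (Fin.ofNat (k + 1) k) = y := by
      rw [show Fin.ofNat (k + 1) k = Fin.last k from Fin.ext (Nat.mod_eq_of_lt (by omega))]
      simp
    have h2 : (Fin.snoc xs y : Fin (k + 1) → M) (Fin.ofNat (k + 1) i) = xs ⟨i, hi⟩ := by
      rw [show Fin.ofNat (k + 1) i = Fin.castSucc ⟨i, hi⟩ from
        Fin.ext (Nat.mod_eq_of_lt (by omega))]
      exact Fin.snoc_castSucc _ _ _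
    have heq : (BoundedFormula.equal (boundVar k k) (boundVar k i)).Realize v
        (Fin.snoc xs y : Fin (k + 1) → M) ↔ y = xs ⟨i, hi⟩ := by
      have : (BoundedFormula.equal (boundVar k k) (boundVar k i)).Realize v
          (Fin.snoc xs y : Fin (k + 1) → M) ↔
          (Fin.snoc xs y : Fin (k + 1) → M) (Fin.ofNat (k + 1) k) =
            (Fin.snoc xs y : Fin (k + 1) → M) (Fin.ofNat (k + 1) i) := Iff.rfl
      rw [this, h1, h2]
    rw [distinctImp, BoundedFormula.realize_imp, BoundedFormula.realize_imp, heq, ih (by omega)]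
    constructor
    · exact fun h hne => h (hne ⟨i, hi⟩ (Nat.lt_succ_self i)) fun j hj => hne j (by omega)
    · intro h hi' hne
      refine h fun j hj => ?_
      rcases Nat.lt_succ_iff_lt_or_eq.1 hj with hj | hj
      · exact hne j hj
      · rwa [show j = ⟨i, hi⟩ from Fin.ext hj]

theorem realize_all_distinctImp {M : Type u} [(modLang ℕ).Structure M] {k : ℕ} (xs : Fin k → M)
    (v : Empty → M) (φ : (modLang ℕ).BoundedFormula Empty (k + 1)) :
    (BoundedFormula.all (distinctImp k φ k)).Realize v xs ↔
      ∀ y ∉ Set.range xs, φ.Realize v (Fin.snoc xs y) := by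
  rw [BoundedFormula.realize_all]
  refine forall_congr' fun y => ?_
  rw [realize_distinctImp xs y v φ k le_rfl]
  refine imp_congr_left ?_
  simp only [Set.mem_range, not_exists, Fin.is_lt, forall_const]
  exact forall_congr' fun j => ne_comm

/-- Each step adjoins one new element to the injective tuple. Finiteness is stated separately
because `Nat.card` is `0` on infinite types, which would clash with `k + j = 0`. -/
theorem realize_exactlyMore {M : Type u} [(modLang ℕ).Structure M] (v : Empty → M) (j : ℕ) :
    ∀ {k : ℕ} (xs : Fin k → M), Function.Injective xs →
      ((exactlyMore j k).Realize v xs ↔ Finite M ∧ Nat.card M = k + j) := by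
  induction j with
  | zero =>
    intro k xs hxs
    rw [exactlyMore, realize_all_distinctImp]
    constructor
    · intro h
      have hsurj : Function.Surjective xs := fun y => not_not.1 fun hy => h y hy
      have e := Equiv.ofBijective xs ⟨hxs, hsurj⟩
      exact ⟨Finite.of_equiv _ e, by rw [← Nat.card_congr e, Nat.card_fin, add_zero]⟩
    · rintro ⟨hfin, hcard⟩ y hy
      have := (Nat.bijective_iff_injective_and_card xs).2 ⟨hxs, by simp [hcard]⟩
      exact (hy (this.2 y)).elim
  | succ j ih =>
    intro k xs hxs
    have hstep : ∀ y ∉ Set.range xs, ((exactlyMore j (k + 1)).Realize v (Fin.snoc xs y) ↔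
        Finite M ∧ Nat.card M = k + (j + 1)) := fun y hy => by
      rw [ih _ (Fin.snoc_injective_iff.2 ⟨hxs, hy⟩), add_assoc, add_comm 1 j]
    rw [exactlyMore, BoundedFormula.realize_imp, realize_all_distinctImp]
    constructor
    · intro h
      by_contra hc
      exact h fun y hy hr => hc ((hstep y hy).1 hr)
    · intro h hall
      -- A tuple of length `k` cannot exhaust `k + (j + 1)` elements.
      obtain ⟨y, hy⟩ : ∃ y, y ∉ Set.range xs := by
        by_contra hc
        push Not at hc
        have := Nat.card_congr (Equiv.ofBijective xs ⟨hxs, hc⟩)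
        rw [Nat.card_fin, h.2] at this
        omega
      exact hall y hy ((hstep y hy).2 h)

theorem realize_foldr_imp {M : Type u} [(modLang ℕ).Structure M] (cs : List ℕ)
    (f : ℕ → (modLang ℕ).Sentence) (ψ : (modLang ℕ).Sentence) :
    Sentence.Realize M (cs.foldr (fun c φ => .imp (f c) φ) ψ) ↔
      ((∀ c ∈ cs, Sentence.Realize M (f c)) → Sentence.Realize M ψ) := by
  induction cs with
  | nil => simp
  | cons c cs ih =>
    have : Sentence.Realize M ((c :: cs).foldr (fun c φ => .imp (f c) φ) ψ) ↔
        (Sentence.Realize M (f c) →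
          Sentence.Realize M (cs.foldr (fun c φ => .imp (f c) φ) ψ)) := Iff.rfl
    rw [this, ih]
    simp

variable {R : Type u} [CommRing R] (a : ℕ → R) (M : Type u) [AddCommGroup M] [Module R M]

/-- An `R`-module as a structure for the language with indices of scalars. -/
abbrev indexStructure : (modLang ℕ).Structure M :=
  letI := moduleStructure R M
  (scalarHom a).reduct M

theorem trueIn_interpret_iff (φ : (modLang ℕ).Sentence) :
    TrueIn M (interpret a φ) ↔ @Sentence.Realize (modLang ℕ) M (indexStructure a M) φ := by
  let := moduleStructure R M
  let := indexStructure a M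
  have : (scalarHom a).IsExpansionOn M := LHom.isExpansionOn_reduct _ M
  exact LHom.realize_onSentence M (scalarHom a) φ

/-- The conjunction is encoded as the negation of a chain of implications ending in a contradiction.
-/
theorem trueIn_witnessSentence_iff {p n : ℕ} (hp : p.Prime) (cs : List ℕ) (d : ℕ) :
    TrueIn M (interpret a (witnessSentence (p, n, cs, d))) ↔
      WitnessModule p n {c | c ∈ cs.map a} (a d) M := by
  rw [trueIn_interpret_iff]
  let := indexStructure a M
  have hkill : ∀ c, Sentence.Realize M (killedBy c) ↔ a c ∈ Module.annihilator R M := fun c =>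
    Module.mem_annihilator.symm
  have htf : Sentence.Realize M (torsionFreeFor d) ↔ ∀ x : M, a d • x = 0 → x = 0 := Iff.rfl
  have hcard : Sentence.Realize M (exactlyMore (p ^ n) 0) ↔ Nat.card M = p ^ n := by
    refine (realize_exactlyMore _ (p ^ n) _ (Function.injective_of_subsingleton _)).trans ?_
    rw [zero_add]
    -- Since `p ^ n` is nonzero, the cardinality equation already forces finiteness.
    exact ⟨And.right, fun h => ⟨Nat.finite_of_card_ne_zero
      (by rw [h]; exact (pow_pos hp.pos n).ne'), h⟩⟩
  have hmain : Sentence.Realize M (witnessSentence (p, n, cs, d)) ↔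
      ¬ Sentence.Realize M (cs.foldr (fun c φ => .imp (killedBy c) φ)
        (.imp (torsionFreeFor d) (.imp (exactlyMore (p ^ n) 0) .falsum))) := Iff.rfl
  have hinner : Sentence.Realize M
      (.imp (torsionFreeFor d) (.imp (exactlyMore (p ^ n) 0) .falsum)) ↔
      (Sentence.Realize M (torsionFreeFor d) → ¬ Sentence.Realize M (exactlyMore (p ^ n) 0)) :=
    Iff.rfl
  rw [hmain, realize_foldr_imp, hinner, htf, hcard, WitnessModule]
  simp only [hkill, Set.mem_ofPred_eq, List.forall_mem_map]
  tauto

end Semantics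

/-! ### Gödel numbers of these sentences -/

section Codes

/-- Gödel number of an implication. -/
def impCode (x y : ℕ) : ℕ := Nat.pair 2 (Nat.pair x y)

/-- Gödel number of an equation. -/
def eqCode (x y : ℕ) : ℕ := Nat.pair 1 (Nat.pair x y)

/-- Gödel number of `⊥`. -/
def botCode : ℕ := Nat.pair 0 0

/-- Gödel number of `s • x_0`. -/
def smulCode (s : ℕ) : ℕ := Nat.pair (s + 3) (Nat.pair (Nat.pair 0 0) 0 + 1)

/-- Gödel number of `0`. -/
def zeroCode : ℕ := Nat.pair 1 0

/-- Gödel number of `∀ x_k, x_k ≠ x_0 → ⋯ → x_k ≠ x_{k-1} → φ` from that of `φ`. -/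
def allDistinctCode (k x : ℕ) : ℕ :=
  Nat.pair 3 (Nat.rec x (fun i y => impCode
    (impCode (eqCode (Nat.pair 0 (k % (k + 1))) (Nat.pair 0 (i % (k + 1)))) botCode) y) k)

/-- Gödel number of `exactlyMore j (N - j)`. -/
def exactlyMoreCode (N j : ℕ) : ℕ :=
  Nat.rec (allDistinctCode N botCode)
    (fun t y => impCode (allDistinctCode (N - (t + 1)) (impCode y botCode)) botCode) j

theorem formulaCode_all_distinctImp (k : ℕ) (φ : (modLang ℕ).BoundedFormula Empty (k + 1)) :
    formulaCode (.all (distinctImp k φ k)) = allDistinctCode k (formulaCode φ) := by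
  have : ∀ i, formulaCode (distinctImp k φ i) = Nat.rec (formulaCode φ) (fun i y => impCode
    (impCode (eqCode (Nat.pair 0 (k % (k + 1))) (Nat.pair 0 (i % (k + 1)))) botCode) y) i := by
    intro i
    induction i with
    | zero => rfl
    | succ i ih =>
      change Nat.pair 2 (Nat.pair _ (formulaCode (distinctImp k φ i))) = _
      rw [ih]
      rfl
  change Nat.pair 3 _ = _
  rw [this, allDistinctCode]

/-- The number of free variables grows as `j` drops, but their sum `N` is constant; with `N` as a
parameter the code is an ordinary recursion on `j`, from the innermost formula outwards. -/
theorem formulaCode_exactlyMore (N j : ℕ) (hj : j ≤ N) :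
    formulaCode (exactlyMore j (N - j)) = exactlyMoreCode N j := by
  induction j with
  | zero => exact formulaCode_all_distinctImp N .falsum
  | succ j ih =>
    have h : formulaCode (exactlyMore j (N - (j + 1) + 1)) = exactlyMoreCode N j := by
      rw [← ih (by omega)]
      congr 2 <;> omega
    change impCode (formulaCode (.all (distinctImp (N - (j + 1)) _ (N - (j + 1))))) botCode = _
    rw [formulaCode_all_distinctImp]
    change impCode (allDistinctCode _ (impCode (formulaCode _) botCode)) botCode = _
    rw [h]
    rfl

/-- Gödel number of `witnessSentence x`. -/
def witnessCode (x : ℕ × ℕ × List ℕ × ℕ) : ℕ :=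
  impCode
    (x.2.2.1.foldr (fun c y => impCode (Nat.pair 3 (eqCode (smulCode c) zeroCode)) y)
      (impCode (Nat.pair 3 (impCode (eqCode (smulCode x.2.2.2) zeroCode)
          (eqCode (Nat.pair 0 0) zeroCode)))
        (impCode (exactlyMoreCode (x.1 ^ x.2.1) (x.1 ^ x.2.1)) botCode)))
    botCode

theorem sentenceCode_witnessSentence (x : ℕ × ℕ × List ℕ × ℕ) :
    sentenceCode (witnessSentence x) = witnessCode x := by
  have hfold : ∀ (cs : List ℕ) (ψ : (modLang ℕ).Sentence),
      formulaCode (cs.foldr (fun c φ => .imp (killedBy c) φ) ψ) =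
        cs.foldr (fun c y => impCode (Nat.pair 3 (eqCode (smulCode c) zeroCode)) y)
          (formulaCode ψ) := by
    intro cs ψ
    induction cs with
    | nil => rfl
    | cons c cs ih =>
      change impCode _ (formulaCode (cs.foldr _ _)) = _
      rw [ih]
      rfl
  have hcard := formulaCode_exactlyMore (x.1 ^ x.2.1) _ le_rfl
  rw [Nat.sub_self] at hcard
  rw [witnessCode, ← hcard]
  change impCode (formulaCode (x.2.2.1.foldr (fun c φ => .imp (killedBy c) φ) _)) botCode = _
  rw [hfold]
  rfl

end Codes

/-! ### Primitive recursiveness of the codes and the decision procedure -/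

section Computability

theorem primrec₂_impCode : Primrec₂ impCode :=
  Primrec₂.natPair.comp (Primrec.const 2) Primrec₂.natPair

theorem primrec₂_eqCode : Primrec₂ eqCode :=
  Primrec₂.natPair.comp (Primrec.const 1) Primrec₂.natPair

theorem primrec_smulCode : Primrec smulCode :=
  Primrec₂.natPair.comp (Primrec.nat_add.comp Primrec.id (Primrec.const 3)) (Primrec.const _)

theorem primrec₂_nat_rec {g : ℕ → ℕ} {h : ℕ → ℕ → ℕ → ℕ} (hg : Primrec g)
    (hh : Primrec fun z : ℕ × ℕ × ℕ => h z.1 z.2.1 z.2.2) :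
    Primrec₂ fun m n : ℕ => (Nat.rec (g m) (h m) n : ℕ) :=
  Primrec.nat_rec hg (g := fun m w => h m w.1 w.2) hh

theorem primrec₂_allDistinctCode : Primrec₂ allDistinctCode := by
  have hvar : ∀ {f : (ℕ × ℕ) × ℕ × ℕ → ℕ}, Primrec f →
      Primrec fun z : (ℕ × ℕ) × ℕ × ℕ => Nat.pair 0 (f z % (z.1.1 + 1)) := fun hf =>
    Primrec₂.natPair.comp (Primrec.const 0) (Primrec.nat_mod.comp hf
      (Primrec.succ.comp (Primrec.fst.comp Primrec.fst)))
  have hstep : Primrec₂ fun z w : ℕ × ℕ => impCode (impCode (eqCode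
      (Nat.pair 0 (z.1 % (z.1 + 1))) (Nat.pair 0 (w.1 % (z.1 + 1)))) botCode) w.2 :=
    primrec₂_impCode.comp (primrec₂_impCode.comp (primrec₂_eqCode.comp
      (hvar (Primrec.fst.comp Primrec.fst)) (hvar (Primrec.fst.comp Primrec.snd)))
      (Primrec.const _)) (Primrec.snd.comp Primrec.snd)
  have hrec := Primrec.nat_rec' (Primrec.fst : Primrec (Prod.fst : ℕ × ℕ → ℕ))
    (Primrec.snd : Primrec (Prod.snd : ℕ × ℕ → ℕ)) hstep
  exact (Primrec₂.natPair.comp (Primrec.const 3) hrec).of_eq fun _ => rfl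

theorem primrec₂_exactlyMoreCode : Primrec₂ exactlyMoreCode := by
  unfold exactlyMoreCode
  exact primrec₂_nat_rec (primrec₂_allDistinctCode.comp Primrec.id (Primrec.const _))
    (primrec₂_impCode.comp (primrec₂_allDistinctCode.comp
      (Primrec.nat_sub.comp Primrec.fst (Primrec.succ.comp (Primrec.fst.comp Primrec.snd)))
      (primrec₂_impCode.comp (Primrec.snd.comp Primrec.snd) (Primrec.const _)))
      (Primrec.const _))

theorem primrec₂_pow : Primrec₂ ((· ^ ·) : ℕ → ℕ → ℕ) := by
  have h : Primrec₂ fun m n : ℕ => (Nat.rec 1 (fun _ y => y * m) n : ℕ) :=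
    primrec₂_nat_rec (Primrec.const 1)
      (Primrec.nat_mul.comp (Primrec.snd.comp Primrec.snd) Primrec.fst)
  refine h.of_eq fun m n => ?_
  induction n with
  | zero => rfl
  | succ n ih => rw [pow_succ, ← ih]

theorem primrec_witnessCode : Primrec witnessCode := by
  have hpow : Primrec fun x : ℕ × ℕ × List ℕ × ℕ => x.1 ^ x.2.1 :=
    primrec₂_pow.comp Primrec.fst (Primrec.fst.comp Primrec.snd)
  have heq : ∀ {α : Type} [Primcodable α] {f : α → ℕ}, Primrec f →
      Primrec fun x => eqCode (smulCode (f x)) zeroCode := fun hf =>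
    primrec₂_eqCode.comp (primrec_smulCode.comp hf) (Primrec.const _)
  refine primrec₂_impCode.comp (Primrec.list_foldr
    (Primrec.fst.comp (Primrec.snd.comp Primrec.snd)) (primrec₂_impCode.comp
      (Primrec₂.natPair.comp (Primrec.const 3) (primrec₂_impCode.comp
        (heq (Primrec.snd.comp (Primrec.snd.comp Primrec.snd))) (Primrec.const _)))
      (primrec₂_impCode.comp (primrec₂_exactlyMoreCode.comp hpow hpow) (Primrec.const _)))
    (h := fun _ z => impCode (Nat.pair 3 (eqCode (smulCode z.1) zeroCode)) z.2)
    (primrec₂_impCode.comp (Primrec₂.natPair.comp (Primrec.const 3)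
      (heq (Primrec.fst.comp Primrec.snd))) (Primrec.snd.comp Primrec.snd)))
    (Primrec.const _)

theorem primrecPred_prime : PrimrecPred Nat.Prime := by
  have hrel : PrimrecRel fun m p : ℕ => p % m ≠ 0 ∨ m = 1 :=
    PrimrecPred.or (PrimrecPred.not (Primrec.eq.comp
      (Primrec.nat_mod.comp Primrec.snd Primrec.fst) (Primrec.const 0)))
      (Primrec.eq.comp Primrec.fst (Primrec.const 1))
  refine (PrimrecPred.and (Primrec.nat_le.comp (Primrec.const 2) Primrec.id)
    ((PrimrecRel.forall_lt hrel).comp Primrec.id Primrec.id)).of_eq fun p => ?_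
  rw [Nat.prime_def_lt]
  simp only [id, Nat.dvd_iff_mod_eq_zero, imp_iff_not_or, Ne]

variable {R : Type u} [CommRing R] {a : ℕ → R}

theorem exists_witnessModule_iff_not_mem_theory {p n : ℕ} (hp : p.Prime) (cs : List ℕ) (d : ℕ) :
    (∃ (M : Type u) (_ : AddCommGroup M) (_ : Module R M),
      WitnessModule p n {c | c ∈ cs.map a} (a d) M) ↔
      interpret a (.imp (witnessSentence (p, n, cs, d)) .falsum) ∉ theoryOfModules R := by
  have hneg : ∀ (M : Type u) [AddCommGroup M] [Module R M],
      TrueIn M (interpret a (.imp (witnessSentence (p, n, cs, d)) .falsum)) ↔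
        ¬ WitnessModule p n {c | c ∈ cs.map a} (a d) M := fun M _ _ => by
    rw [← trueIn_witnessSentence_iff a M hp cs d]
    rfl
  simp only [theoryOfModules, Set.mem_ofPred_eq, hneg]
  push Not
  rfl

theorem pPstarRecursive_of_decidableTheory (h : DecidableTheory R a) : PPstarRecursive R a := by
  obtain ⟨f, hf, hfT⟩ := h
  -- The side conditions on the tuple are not expressed by the sentence, so they are tested
  -- separately.
  have hside : PrimrecPred fun x : ℕ × ℕ × List ℕ × ℕ =>
      Nat.Prime x.1 ∧ 0 < x.2.1 ∧ x.2.2.1 ≠ [] :=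
    PrimrecPred.and (primrecPred_prime.comp Primrec.fst) (PrimrecPred.and
      (Primrec.nat_lt.comp (Primrec.const 0) (Primrec.fst.comp Primrec.snd))
      (PrimrecPred.not (Primrec.eq.comp (Primrec.fst.comp (Primrec.snd.comp Primrec.snd))
        (Primrec.const []))))
  obtain ⟨_, hside⟩ := hside
  have hcode : Computable fun x => f (impCode (witnessCode x) botCode) :=
    hf.comp (primrec₂_impCode.comp primrec_witnessCode (Primrec.const _)).to_comp
  refine ComputablePred.computable_iff.2 ⟨fun x =>
    decide (Nat.Prime x.1 ∧ 0 < x.2.1 ∧ x.2.2.1 ≠ []) &&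
      !f (impCode (witnessCode x) botCode),
    Primrec.and.to_comp.comp hside.to_comp (Primrec.not.to_comp.comp hcode), ?_⟩
  funext ⟨p, n, cs, d⟩
  have hdec : f (impCode (witnessCode (p, n, cs, d)) botCode) = true ↔
      interpret a (.imp (witnessSentence (p, n, cs, d)) .falsum) ∈ theoryOfModules R := by
    rw [← hfT, ← sentenceCode_witnessSentence]
    rfl
  rw [mem_PPstar_iff, Bool.and_eq_true, decide_eq_true_eq, Bool.not_eq_true', ← Bool.not_eq_true,
    hdec, eq_iff_iff]
  simp only [Ne, List.map_eq_nil_iff]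
  constructor
  · rintro ⟨hp, hn, hcs, hM⟩
    exact ⟨⟨hp, hn, hcs⟩, (exists_witnessModule_iff_not_mem_theory hp cs d).1 hM⟩
  · rintro ⟨⟨hp, hn, hcs⟩, hM⟩
    exact ⟨hp, hn, hcs, (exists_witnessModule_iff_not_mem_theory hp cs d).2 hM⟩

end Computability

end Sentences
end PruferModules

theorem theorem3p2 {R : Type u} [CommRing R] [IsDomain R]
    (hR : PruferModules.IsPruferDomain R)
    (a : ℕ → R) (ha : PruferModules.EffectiveListing R a) :
    (PruferModules.DecidableTheory R a → PruferModules.PPstarRecursive R a) ∧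
    (∀ (p n l : ℕ) (c : Fin l → R) (d : R), p.Prime → 1 ≤ n → 1 ≤ l →
      ((p, n, c, d) ∈ PruferModules.PPl R l ↔
        ∃ (M : Type u) (_ : AddCommGroup M) (_ : Module R M),
          PruferModules.WitnessModule p n (Set.range c) d M)) ∧
    (∃ θ : ℕ × ℕ × List ℕ × ℕ → (PruferModules.modLang ℕ).Sentence,
      Computable (fun π => PruferModules.sentenceCode (θ π)) ∧
      ∀ (p n : ℕ) (cs : List ℕ) (d : ℕ), p.Prime → 1 ≤ n → cs ≠ [] →
        ∀ (M : Type u) [AddCommGroup M] [Module R M],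
          PruferModules.TrueIn M (PruferModules.interpret a (θ (p, n, cs, d))) ↔
            PruferModules.WitnessModule p n {c | c ∈ cs.map a} (a d) M) := by
  refine ⟨PruferModules.pPstarRecursive_of_decidableTheory, fun p n l c d hp hn _ =>
    PruferModules.mem_PPl_iff_exists_witnessModule hp hn, PruferModules.witnessSentence, ?_,
    fun p n cs d hp _ _ M _ _ => PruferModules.trueIn_witnessSentence_iff a M hp cs d⟩
  exact PruferModules.primrec_witnessCode.to_comp.of_eq fun x =>
    (PruferModules.sentenceCode_witnessSentence x).symm
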